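/- Let $AP$ be a finite non-empty set of atomic propositions. A Markov chain (MC) over $AP$ consists of a countable state set $\mathcal S$, a transition function $\mathcal S\to\mathrm{Dist}(\mathcal S)$, a labelling $L:\mathcal S\to 2^{AP}$ and an initial state $s_0$. PCTL state and path formulas are given by $$\Phi ::= a \mid \Phi_1\wedge\Phi_2\mid\neg\Phi\mid \mathbb P_{\bowtie q}(\varphi),\qquad \varphi ::= \mathsf X\,\Phi\mid \Phi_1\,\mathsf U\,\Phi_2\mid\Phi_1\,\mathsf W\,\Phi_2,$$ with $a\in AP$, $\bowtie\,\in\{<,>,\le,\ge\}$, $q\in[0,1]$, and with the usual semantics: $s\models\mathbb P_{\bowtie q}(\varphi)$ iff the set of infinite paths from $s$ that satisfy $\varphi$ has probability $\bowtie q$. Put $\top=a\vee\neg a$, $\bot=\neg\top$, $\Diamond\Phi=\top\,\mathsf U\,\Phi$; write $D\models\Phi$ if the initial state of $D$ satisfies $\Phi$, and $\Phi\equiv\Psi$ if the same MCs over $AP$ satisfy $\Phi$ and $\Psi$. A probabilistic tree (PT) is a tuple $(W,L,P)$ in which $W\cup\{\epsilon\}\subseteq\mathbb N^*$ is prefix-closed,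 $\epsilon\notin W$, $W$ has exactly one element of length $1$ (the root), $L:W\to 2^{AP}$, and $P$ is a partial function from $W$ to $\mathrm{Dist}(W)$ such that $P(\pi)$ is defined with $P(\pi)(\pi')>0$ iff $\pi'=\pi\cdot n\in W$ for some $n\in\mathbb N$. It is total if every node is a proper prefix of another node; $\mathbb T^\omega$ is the set of total PTs. A total PT $T_2=(W_2,L_2,P_2)$ is a suffix of a total PT $T_1=(W_1,L_1,P_1)$ if there is $\pi_1\in W_1$ such that $\pi_1\cdot\pi_2\in W_1$, $L_2(\pi_2)=L_1(\pi_1\cdot\pi_2)$ and $P_2(\pi_2)(\pi_2')=P_1(\pi_1\cdot\pi_2)(\pi_1\cdot\pi_2')$ for all $\pi_2,\pi_2'\in W_2$. A set $P\subseteq\mathbb T^\omega$ is an absolute liveness property if $P\ne\emptyset$ and, for all $T,T'\in\mathbb T^\omega$ such that $T'$ is a suffix of $T$, $T'\in P$ implies $T\in P$. The unfolding $T(D)$ of an MC $D$ is the tree whose nodes are the finite state sequences that start in $s_0$ and follow transitions of positive probability; a node carries the label of its last state $s$, and the edge from $\pi$ to $\pi\cdot t$ carries the probability of the transition from $s$ to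 $t$. A formula $\Phi$ is called an absolute liveness property if the set $$P_\Phi=\{T\in\mathbb T^\omega\mid T\cong T(D)\text{ for some MC } D\models\Phi\}$$ is one, where $\cong$ is equality up to a renaming of nodes (a bijection of the nodes that preserves labels and edge probabilities). Theorem. A PCTL formula $\Phi$ is an absolute liveness property if and only if $\Phi\not\equiv\bot$ (that is, $\Phi$ is satisfiable) and $\Phi\equiv\mathbb P_{>0}(\Diamond\Phi)$. -/

import Mathlib

open scoped ENNReal

noncomputable section

/-! ### Markov chains and their path measures -/

/-- A discrete-time Markov chain labelled over `AP`: a countable set of states, a transition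
function into the distributions over states, a labelling function and an initial state.
(Every countable set is in bijection with one in `Type`.) -/
structure MarkovChain (AP : Type*) where
  State : Type
  countable : Countable State
  step : State → PMF State
  label : State → Set AP
  init : State

namespace MarkovChain

variable {AP : Type*}

instance (D : MarkovChain AP) : Countable D.State := D.countable

/-- Every set of states is measurable; the `σ`-algebra on infinite sequences of states is the
induced product `σ`-algebra, which is the one generated by the cylinder sets. -/
instance (D : MarkovChain AP) : MeasurableSpace D.State := ⊤

instance (D : MarkovChain AP) : DiscreteMeasurableSpace D.State := ⟨fun _ => trivial⟩

/-- The transition function as a Markov kernel on states. -/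
def stepKernel (D : MarkovChain AP) : ProbabilityTheory.Kernel D.State D.State where
  toFun s := (D.step s).toMeasure
  measurable' := Measurable.of_discrete

instance (D : MarkovChain AP) : ProbabilityTheory.IsMarkovKernel D.stepKernel :=
  ⟨fun s => PMF.toMeasure.isProbabilityMeasure (D.step s)⟩

/-- The transition from a history `s₀ … sₙ` to the state at time `n + 1`, which depends only on the
last state `sₙ` of the history. -/
def historyKernel (D : MarkovChain AP) (n : ℕ) :
    ProbabilityTheory.Kernel ((_ : Finset.Iic n) → D.State) D.State :=
  D.stepKernel.comap (fun h => h ⟨n, Finset.mem_Iic.2 le_rfl⟩) (measurable_pi_apply _)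

instance (D : MarkovChain AP) (n : ℕ) :
    ProbabilityTheory.IsMarkovKernel (D.historyKernel n) := by
  unfold historyKernel; infer_instance

/-- The probability measure `Pr` on the infinite sequences of states of the chain started in `s`
(by the Ionescu-Tulcea theorem). -/
def pathMeasure (D : MarkovChain AP) (s : D.State) : MeasureTheory.Measure (ℕ → D.State) :=
  ProbabilityTheory.Kernel.traj (X := fun _ => D.State) D.historyKernel 0 (fun _ => s)

instance (D : MarkovChain AP) (s : D.State) :
    MeasureTheory.IsProbabilityMeasure (D.pathMeasure s) := by
  unfold pathMeasure; infer_instance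

end MarkovChain

/-! ### Probabilistic CTL -/

namespace PCTL

/-- The comparison operators `<`, `>`, `≤`, `≥`. -/
inductive Cmp
  | lt | gt | le | ge

/-- The relation on the reals denoted by a comparison operator. -/
def Cmp.holds : Cmp → ℝ → ℝ → Prop
  | .lt, x, y => x < y
  | .gt, x, y => x > y
  | .le, x, y => x ≤ y
  | .ge, x, y => x ≥ y

universe u

mutual

/-- State formulas: `a`, `Φ₁ ∧ Φ₂`, `¬ Φ` and `P_{⋈ q}(φ)` with `q ∈ [0, 1]`. -/
inductive StateFormula (AP : Type u)
  | atom (a : AP) : StateFormula AP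
  | and (Φ Ψ : StateFormula AP) : StateFormula AP
  | neg (Φ : StateFormula AP) : StateFormula AP
  | prob (c : Cmp) (q : unitInterval) (φ : PathFormula AP) : StateFormula AP

/-- Path formulas: `X Φ`, `Φ₁ U Φ₂` and `Φ₁ W Φ₂`. -/
inductive PathFormula (AP : Type u)
  | next (Φ : StateFormula AP) : PathFormula AP
  | until (Φ Ψ : StateFormula AP) : PathFormula AP
  | weakUntil (Φ Ψ : StateFormula AP) : PathFormula AP

end

variable {AP : Type*}

mutual

/-- Satisfaction `s ⊨ Φ` of a state formula in a state of a Markov chain. -/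
def SatState (D : MarkovChain AP) : StateFormula AP → D.State → Prop
  | .atom a, s => a ∈ D.label s
  | .and Φ Ψ, s => SatState D Φ s ∧ SatState D Ψ s
  | .neg Φ, s => ¬ SatState D Φ s
  | .prob c q φ, s =>
      c.holds ((D.pathMeasure s).real {π : ℕ → D.State | π 0 = s ∧ SatPath D φ π}) q

/-- Satisfaction `π ⊨ φ` of a path formula on an infinite sequence of states. -/
def SatPath (D : MarkovChain AP) : PathFormula AP → (ℕ → D.State) → Prop
  | .next Φ, π => SatState D Φ (π 1)
  | .until Φ Ψ, π => ∃ j, SatState D Ψ (π j) ∧ ∀ k < j, SatState D Φ (π k)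
  | .weakUntil Φ Ψ, π =>
      (∃ j, SatState D Ψ (π j) ∧ ∀ k < j, SatState D Φ (π k)) ∨ ∀ i, SatState D Φ (π i)

end

/-- `D ⊨ Φ`: the initial state satisfies `Φ`. -/
def Models (D : MarkovChain AP) (Φ : StateFormula AP) : Prop := SatState D Φ D.init

namespace StateFormula

/-- `Φ ∨ Ψ`. -/
def or (Φ Ψ : StateFormula AP) : StateFormula AP := neg (and (neg Φ) (neg Ψ))

/-- `⊤ = a ∨ ¬ a` for some atomic proposition `a`. -/
def top [Nonempty AP] : StateFormula AP :=
  or (atom (Classical.arbitrary AP)) (neg (atom (Classical.arbitrary AP)))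

/-- `⊥ = ¬ ⊤`. -/
def bot [Nonempty AP] : StateFormula AP := neg top

/-- Positive-probability reachability `P_{> 0}(◇ Φ)`, where `◇ Φ = ⊤ U Φ`. -/
def posReach [Nonempty AP] (Φ : StateFormula AP) : StateFormula AP :=
  prob Cmp.gt 0 (PathFormula.until top Φ)

/-- Equivalence `Φ ≡ Ψ`: the same Markov chains satisfy `Φ` and `Ψ`. -/
def Equivalent (Φ Ψ : StateFormula AP) : Prop :=
  ∀ D : MarkovChain AP, Models D Φ ↔ Models D Ψ

end StateFormula

end PCTL

/-! ### Probabilistic trees -/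

/-- A probabilistic tree whose nodes are non-empty finite sequences over `N`. The node of length one
is the root. `edge` is a partial function: it is undefined (`none`) at the leaves. -/
structure PTree (N : Type*) (AP : Type*) where
  nodes : Set (List N)
  nil_notMem : [] ∉ nodes
  prefix_mem : ∀ π ∈ nodes, ∀ π', π' <+: π → π' ≠ [] → π' ∈ nodes
  root : ∃! n : N, [n] ∈ nodes
  label : nodes → Set AP
  edge : nodes → Option (PMF nodes)
  edge_pos : ∀ π π' : nodes,
    (∃ μ, edge π = some μ ∧ 0 < μ π') ↔ ∃ n : N, (π' : List N) = (π : List N) ++ [n]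

namespace PTree

variable {N M AP : Type*}

/-- The probability `P(π)(π')` on the edge from `π` to `π'` (zero where `P(π)` is undefined). -/
def prob (T : PTree N AP) (π π' : T.nodes) : ℝ≥0∞ := (T.edge π).elim 0 (fun μ => μ π')

/-- Every node has a proper extension in the tree. -/
def IsTotal (T : PTree N AP) : Prop :=
  ∀ π₁ ∈ T.nodes, ∃ π₂ ∈ T.nodes, π₁ <+: π₂ ∧ π₁ ≠ π₂

/-- `T₂` is a suffix of `T₁`. -/
def IsSuffix (T₂ T₁ : PTree N AP) : Prop :=
  ∃ π₁ ∈ T₁.nodes, ∃ h : ∀ π₂ ∈ T₂.nodes, π₁ ++ π₂ ∈ T₁.nodes,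
    (∀ π₂ : T₂.nodes, T₂.label π₂ = T₁.label ⟨π₁ ++ π₂, h π₂ π₂.2⟩) ∧
    ∀ π₂ π₂' : T₂.nodes,
      T₂.prob π₂ π₂' = T₁.prob ⟨π₁ ++ π₂, h π₂ π₂.2⟩ ⟨π₁ ++ π₂', h π₂' π₂'.2⟩

/-- Equality of probabilistic trees up to renaming of nodes: a bijection between the nodes that
preserves labels and edge probabilities (hence also the child relation, the root and the leaves,
since an edge has positive probability exactly when it leads to a child). -/
def Iso (T₁ : PTree N AP) (T₂ : PTree M AP) : Prop :=
  ∃ e : T₁.nodes ≃ T₂.nodes,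
    (∀ π, T₁.label π = T₂.label (e π)) ∧ ∀ π π', T₁.prob π π' = T₂.prob (e π) (e π')

end PTree

/-! ### The unfolding of a Markov chain -/

namespace MarkovChain

variable {AP : Type*}

/-- The node set of the unfolding: the least set of finite sequences of states that contains the
initial state and with `π · s` also `π · s · t` for every `t` in the support of the distribution
of `s`. -/
inductive IsNode (D : MarkovChain AP) : List D.State → Prop
  | root : IsNode D [D.init]
  | snoc {π : List D.State} {s t : D.State} :
      IsNode D (π ++ [s]) → t ∈ (D.step s).support → IsNode D (π ++ [s] ++ [t])

theorem IsNode.ne_nil {D : MarkovChain AP} {π : List D.State} (h : D.IsNode π) : π ≠ [] := by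
  cases h <;> simp

theorem IsNode.append {D : MarkovChain AP} {π : List D.State} (h : D.IsNode π) {t : D.State}
    (ht : t ∈ (D.step (π.getLast h.ne_nil)).support) : D.IsNode (π ++ [t]) := by
  have hπ : π.dropLast ++ [π.getLast h.ne_nil] = π := List.dropLast_append_getLast h.ne_nil
  have h' : D.IsNode (π.dropLast ++ [π.getLast h.ne_nil]) := hπ.symm ▸ h
  have := IsNode.snoc h' ht
  rwa [hπ] at this

theorem IsNode.of_append {D : MarkovChain AP} {π : List D.State} (h : D.IsNode π) {t : D.State}
    (ht : D.IsNode (π ++ [t])) : t ∈ (D.step (π.getLast h.ne_nil)).support := by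
  generalize hρ : π ++ [t] = ρ at ht
  cases ht with
  | root =>
    have := h.ne_nil
    simp_all [List.append_eq_singleton_iff]
  | snoc h1 h2 =>
    obtain ⟨rfl, h4⟩ := List.append_inj' hρ rfl
    simp only [List.cons.injEq, and_true] at h4
    subst h4
    simpa using h2

theorem IsNode.prefix_mem {D : MarkovChain AP} {π : List D.State} (h : D.IsNode π) :
    ∀ π', π' <+: π → π' ≠ [] → D.IsNode π' := by
  induction h with
  | root =>
    intro π' h1 h2
    rcases List.prefix_concat_iff (l₂ := []) |>.1 h1 with h | h
    · rw [h]; exact IsNode.root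
    · exact absurd (List.prefix_nil.1 h) h2
  | snoc h1 h2 ih =>
    intro π' h3 h4
    rcases List.prefix_concat_iff.1 h3 with h | h
    · rw [h]; exact IsNode.snoc h1 h2
    · exact ih π' h h4

theorem IsNode.singleton {D : MarkovChain AP} {s : D.State} (h : D.IsNode [s]) : s = D.init := by
  generalize hρ : [s] = ρ at h
  cases h with
  | root => simpa using hρ
  | snoc h1 h2 =>
    have := congrArg List.length hρ
    simp at this

/-- The unfolding `T(D)`: the label of a node is the label of its last state, and a node `π` with
last state `s` has the edge to `π · t` with the probability of the transition from `s` to `t`. -/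
def unfolding (D : MarkovChain AP) : PTree D.State AP where
  nodes := {π | D.IsNode π}
  nil_notMem h := IsNode.ne_nil h rfl
  prefix_mem _ h := h.prefix_mem
  root := ⟨D.init, IsNode.root, fun _ h => IsNode.singleton h⟩
  label π := D.label (π.1.getLast (IsNode.ne_nil π.2))
  edge π := some ((D.step (π.1.getLast (IsNode.ne_nil π.2))).bindOnSupport
    fun t ht => PMF.pure ⟨π.1 ++ [t], IsNode.append π.2 ht⟩)
  edge_pos π π' := by
    have key : ∀ μ : PMF {π | D.IsNode π}, 0 < μ π' ↔ π' ∈ μ.support := fun μ => by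
      rw [PMF.mem_support_iff, pos_iff_ne_zero]
    simp only [Option.some.injEq, exists_eq_left', key, PMF.mem_support_bindOnSupport_iff,
      PMF.mem_support_pure_iff]
    constructor
    · rintro ⟨t, ht, h⟩
      exact ⟨t, by rw [h]⟩
    · rintro ⟨t, h⟩
      exact ⟨t, IsNode.of_append π.2 (h ▸ π'.2), Subtype.ext h⟩

end MarkovChain

/-! ### Properties and absolute liveness -/

/-- The total probabilistic trees over `AP`. -/
abbrev TotalPT (AP : Type*) := {T : PTree ℕ AP // T.IsTotal}

/-- A property (set of total probabilistic trees) is an absolute liveness property if it is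
non-empty and contains every total tree that has a suffix in it. -/
def IsAbsoluteLiveness {AP : Type*} (P : Set (TotalPT AP)) : Prop :=
  P.Nonempty ∧ ∀ T T' : TotalPT AP, T'.1.IsSuffix T.1 → T' ∈ P → T ∈ P

/-- The property of a formula: the unfoldings of the Markov chains that satisfy it, where
probabilistic trees are identified up to renaming of nodes. -/
def PCTL.StateFormula.property {AP : Type*} (Φ : PCTL.StateFormula AP) : Set (TotalPT AP) :=
  {T | ∃ D : MarkovChain AP, PCTL.Models D Φ ∧ T.1.Iso D.unfolding}

end

noncomputable section

section

open MeasureTheory ProbabilityTheory Finset Preorder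

namespace MarkovChain

variable {AP : Type*}

/-! ### Path measures -/

-- A total tree is itself a Markov chain, with its nodes as states (`PTree.chain`). Maps that
-- preserve labels and transition distributions carry path measures to path measures
-- (`IsHom.pathMeasure_map`) and hence preserve all PCTL formulas (`satState_iff_of_isHom`). The
-- last-state map of an unfolding, the bijection of an isomorphism and the inclusion of a suffix are
-- such maps. Therefore a tree lies in the property of `Φ` exactly when its own chain satisfies `Φ`
-- (`mem_property_iff`), whichever chain witnesses membership.
--
-- Moreover, `Φ.posReach` holds in a state exactly when some `Φ`-state can be reached from it
-- (`satState_posReach_iff`). Restarting a chain at a reached state gives a suffix of its unfolding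
-- (`isSuffix_unfolding_withInit`), and a suffix of a tree is rooted at a node reachable from the
-- root (`IsSuffix.models_posReach`). So closure under trees with a suffix in the property says that
-- `Φ.posReach` implies `Φ`; the converse implication always holds, since a state reaches itself.
-- Non-emptiness is satisfiability. Because trees have nodes over `ℕ`, chains are recoded with
-- states in `ℕ` (`natChain`).

theorem historyKernel_apply (D : MarkovChain AP) (n : ℕ) (h : (_ : Iic n) → D.State) :
    D.historyKernel n h = (D.step (h ⟨n, mem_Iic.2 le_rfl⟩)).toMeasure := rfl

theorem pathMeasure_map_frestrictLe_zero (D : MarkovChain AP) (s : D.State) :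
    (D.pathMeasure s).map (frestrictLe (π := fun _ => D.State) 0) = Measure.dirac fun _ => s := by
  rw [pathMeasure, Kernel.traj_map_frestrictLe_apply, Kernel.partialTraj_self, Kernel.id_apply]

/-- The Markov property in the form used by the inductions on time below. -/
theorem pathMeasure_map_prodMk (D : MarkovChain AP) (s : D.State) (n : ℕ) :
    (D.pathMeasure s).map (fun x => (frestrictLe (π := fun _ => D.State) n x, x (n + 1))) =
      (D.pathMeasure s).map (frestrictLe (π := fun _ => D.State) n) ⊗ₘ D.historyKernel n := by
  rw [pathMeasure, ← Kernel.partialTraj_compProd_eq_map_traj (X := fun _ => D.State) (Nat.zero_le n),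
    Kernel.traj_map_frestrictLe_apply]

theorem ae_pathMeasure_zero (D : MarkovChain AP) (s : D.State) :
    ∀ᵐ π ∂D.pathMeasure s, π 0 = s := by
  have h : ∀ᵐ h ∂(D.pathMeasure s).map (frestrictLe (π := fun _ => D.State) 0),
      h ⟨0, mem_Iic.2 le_rfl⟩ = s := by
    rw [pathMeasure_map_frestrictLe_zero, ae_dirac_iff]
    exact measurableSet_eq_fun (measurable_pi_apply _) measurable_const
  exact ae_of_ae_map (measurable_frestrictLe 0).aemeasurable h

/-- The law of the state at time `n + 1` in terms of the state at time `n`. -/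
theorem pathMeasure_succ (D : MarkovChain AP) (s : D.State) (n : ℕ) (t : D.State) :
    D.pathMeasure s {π | π (n + 1) = t} = ∫⁻ π, D.step (π n) t ∂D.pathMeasure s := by
  have h := congrArg (fun μ => μ (Prod.snd ⁻¹' {t})) (D.pathMeasure_map_prodMk s n)
  have hm : MeasurableSet (Prod.snd ⁻¹' {t} : Set (((_ : Iic n) → D.State) × D.State)) :=
    measurable_snd (MeasurableSet.of_discrete)
  beta_reduce at h
  rw [Measure.map_apply (by fun_prop) hm, Measure.compProd_apply hm,
    lintegral_map (Kernel.measurable_kernel_prodMk_left hm) (measurable_frestrictLe n)] at h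
  refine Eq.trans h (lintegral_congr fun π => ?_)
  rw [historyKernel_apply]
  exact PMF.toMeasure_apply_singleton _ _ MeasurableSet.of_discrete

/-! ### Homomorphisms -/

/-- A homomorphism of Markov chains preserves labels and transition distributions; it need not
preserve the initial state. -/
structure IsHom (D D' : MarkovChain AP) (f : D.State → D'.State) : Prop where
  label : ∀ s, D.label s = D'.label (f s)
  step : ∀ s, (D.step s).map f = D'.step (f s)

namespace IsHom

variable {D D' : MarkovChain AP} {f : D.State → D'.State}

theorem historyKernel_map (hf : IsHom D D' f) (n : ℕ) (h : (_ : Iic n) → D.State) :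
    (D.historyKernel n h).map f = D'.historyKernel n (f ∘ h) := by
  rw [historyKernel_apply, historyKernel_apply, PMF.toMeasure_map f _ Measurable.of_discrete, hf.step]
  rfl

theorem measurable_comp (f : D.State → D'.State) (ι : Type*) :
    Measurable fun π : ι → D.State => f ∘ π :=
  measurable_pi_lambda _ fun i => (Measurable.of_discrete (f := f)).comp (measurable_pi_apply i)

/-- Induction on `n`: the law of a history with its next state is a composition-product, and `f`
intertwines the two transition kernels by `historyKernel_map`. -/
theorem pathMeasure_map_frestrictLe (hf : IsHom D D' f) (s : D.State) (n : ℕ) :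
    ((D.pathMeasure s).map (frestrictLe (π := fun _ => D.State) n)).map (f ∘ ·) =
      (D'.pathMeasure (f s)).map (frestrictLe (π := fun _ => D'.State) n) := by
  induction n with
  | zero =>
    rw [pathMeasure_map_frestrictLe_zero, pathMeasure_map_frestrictLe_zero,
      Measure.map_dirac' (measurable_comp f _)]
    rfl
  | succ n ih =>
    have key : ((D.pathMeasure s).map
          (fun x => (frestrictLe (π := fun _ => D.State) n x, x (n + 1)))).map
          (Prod.map (f ∘ ·) f) =
        (D'.pathMeasure (f s)).map
          (fun x => (frestrictLe (π := fun _ => D'.State) n x, x (n + 1))) := by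
      rw [pathMeasure_map_prodMk, pathMeasure_map_prodMk, ← ih]
      have hF : Measurable (Prod.map (f ∘ ·) f :
          ((_ : Iic n) → D.State) × D.State → ((_ : Iic n) → D'.State) × D'.State) :=
        (measurable_comp f _).prodMap Measurable.of_discrete
      have := Measure.isFiniteMeasure_map (D.pathMeasure s) (frestrictLe (π := fun _ => D.State) n)
      ext S hS
      rw [Measure.map_apply hF hS, Measure.compProd_apply (hF hS), Measure.compProd_apply hS,
        lintegral_map (Kernel.measurable_kernel_prodMk_left hS) (measurable_comp f _)]
      refine lintegral_congr fun h => ?_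
      rw [← hf.historyKernel_map, Measure.map_apply Measurable.of_discrete
        (measurable_prodMk_left hS)]
      rfl
    -- `G` glues a history up to time `n` and the state at time `n + 1` into one longer history.
    let G : ((_ : Iic n) → D'.State) × D'.State → ((_ : Iic (n + 1)) → D'.State) :=
      fun p i => if hi : (i : ℕ) ≤ n then p.1 ⟨i, mem_Iic.2 hi⟩ else p.2
    have hG : Measurable G := by
      refine measurable_pi_lambda _ fun i => ?_
      by_cases hi : (i : ℕ) ≤ n
      · simpa [G, hi, Function.comp_def] using (measurable_pi_apply _).comp measurable_fst
      · simpa [G, hi] using measurable_snd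
    have hG' : ∀ x : ℕ → D'.State, G (frestrictLe (π := fun _ => D'.State) n x, x (n + 1)) =
        frestrictLe (π := fun _ => D'.State) (n + 1) x := by
      intro x
      funext i
      by_cases hi : (i : ℕ) ≤ n
      · simp [G, hi]
      · have : (i : ℕ) = n + 1 := le_antisymm (mem_Iic.1 i.2) (by omega)
        simp [G, this]
    have h := congrArg (Measure.map G) key
    rw [Measure.map_map hG ((measurable_comp f _).prodMap Measurable.of_discrete),
      Measure.map_map (hG.comp ((measurable_comp f _).prodMap Measurable.of_discrete))
        (by fun_prop), Measure.map_map hG (by fun_prop)] at h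
    rw [Measure.map_map (measurable_comp f _) (measurable_frestrictLe _)]
    convert h using 2
    · funext x
      exact (hG' (f ∘ x)).symm
    · funext x
      exact (hG' x).symm

/-- The path measures are preserved by homomorphisms. -/
theorem pathMeasure_map (hf : IsHom D D' f) (s : D.State) :
    (D.pathMeasure s).map (f ∘ ·) = D'.pathMeasure (f s) := by
  let P : (I : Finset ℕ) → Measure ((_ : I) → D'.State) := inducedFamily (X := fun _ => D'.State) fun n =>
    Kernel.partialTraj (X := fun _ => D'.State) D'.historyKernel 0 n fun _ => f s
  have (I : Finset ℕ) : IsFiniteMeasure (P I) := by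
    have (n : ℕ) : IsFiniteMeasure
        (Kernel.partialTraj (X := fun _ => D'.State) D'.historyKernel 0 n fun _ => f s) :=
      inferInstance
    exact inferInstanceAs (IsFiniteMeasure (inducedFamily (X := fun _ => D'.State) _ I))
  have h : IsProjectiveLimit (D'.pathMeasure (f s)) P :=
    Kernel.isProjectiveLimit_trajFun (X := fun _ => D'.State) D'.historyKernel 0 fun _ => f s
  have hp : IsProjectiveMeasureFamily (α := fun _ => D'.State) P :=
    Kernel.isProjectiveMeasureFamily_partialTraj (X := fun _ => D'.State) D'.historyKernel
      (a := 0) fun _ => f s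
  -- A finite measure on infinite sequences is determined by its marginals on initial segments.
  refine IsProjectiveLimit.unique ((isProjectiveLimit_nat_iff (X := fun _ => D'.State) hp _).2 fun n => ?_) h
  have h1 := hf.pathMeasure_map_frestrictLe s n
  rw [Measure.map_map (measurable_comp f _) (measurable_frestrictLe _)] at h1
  rw [← h (Iic n), Measure.map_map (measurable_frestrictLe _) (measurable_comp f _)]
  exact h1

end IsHom

/-! ### Reachability -/

/-- The states that can be reached from `s` by transitions of positive probability. -/
def Reaches (D : MarkovChain AP) : D.State → D.State → Prop :=
  Relation.ReflTransGen fun s t => t ∈ (D.step s).support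

/-- The integral in `pathMeasure_succ` vanishes iff the integrand is almost surely zero; as there
are countably many states, this can be tested separately for each value `u` of `π n`. -/
theorem pathMeasure_succ_ne_zero_iff (D : MarkovChain AP) (s : D.State) (n : ℕ) (t : D.State) :
    D.pathMeasure s {π | π (n + 1) = t} ≠ 0 ↔
      ∃ u, D.pathMeasure s {π | π n = u} ≠ 0 ∧ t ∈ (D.step u).support := by
  have hm : Measurable fun π : ℕ → D.State => D.step (π n) t :=
    (Measurable.of_discrete (f := fun u => D.step u t)).comp (measurable_pi_apply n)
  rw [pathMeasure_succ, Ne, lintegral_eq_zero_iff hm, ← not_iff_not, not_not]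
  push Not
  have h : (fun π : ℕ → D.State => D.step (π n) t) =ᵐ[D.pathMeasure s] 0 ↔
      ∀ u, ∀ᵐ π ∂D.pathMeasure s, π n = u → D.step u t = 0 := by
    rw [← ae_all_iff]
    refine Filter.eventually_congr (Filter.Eventually.of_forall fun π => ?_)
    simp
  rw [h]
  refine forall_congr' fun u => ?_
  rw [PMF.mem_support_iff]
  by_cases hu : D.step u t = 0
  · simp [hu]
  · simp [hu, ae_iff]

theorem reaches_iff (D : MarkovChain AP) (s t : D.State) :
    D.Reaches s t ↔ ∃ n, D.pathMeasure s {π | π n = t} ≠ 0 := by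
  constructor
  · intro h
    induction h with
    | refl =>
      refine ⟨0, fun h => ?_⟩
      have h1 : ∀ᵐ π ∂D.pathMeasure s, π 0 ≠ s := by simpa [ae_iff] using h
      have h2 : ∀ᵐ π ∂D.pathMeasure s, False := by
        filter_upwards [h1, D.ae_pathMeasure_zero s] with π h1 h2 using h1 h2
      exact h2.exists.elim fun _ h => h
    | tail _ h ih =>
      obtain ⟨n, hn⟩ := ih
      exact ⟨n + 1, (D.pathMeasure_succ_ne_zero_iff s n _).2 ⟨_, hn, h⟩⟩
  · rintro ⟨n, hn⟩
    induction n generalizing t with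
    | zero =>
      by_contra hst
      have hne : s ≠ t := fun h => hst (h ▸ Relation.ReflTransGen.refl)
      refine hn (measure_mono_null (fun π (hπ : π 0 = t) => ?_) (ae_iff.1 (D.ae_pathMeasure_zero s)))
      exact fun h => hne (h.symm.trans hπ)
    | succ n ih =>
      obtain ⟨u, hu, h⟩ := (D.pathMeasure_succ_ne_zero_iff s n t).1 hn
      exact Relation.ReflTransGen.tail (ih u hu) h

end MarkovChain

-- PCTL semantics: invariance under homomorphisms and reachability

namespace PCTL

variable {AP : Type*}

theorem measurableSet_satPath (D : MarkovChain AP) (φ : PathFormula AP) :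
    MeasurableSet {π | SatPath D φ π} := by
  have h (Φ : StateFormula AP) (n : ℕ) : MeasurableSet {π : ℕ → D.State | SatState D Φ (π n)} :=
    measurable_pi_apply n (MeasurableSet.of_discrete (s := {s | SatState D Φ s}))
  have hU (Φ Ψ : StateFormula AP) : MeasurableSet
      {π : ℕ → D.State | ∃ j, SatState D Ψ (π j) ∧ ∀ k < j, SatState D Φ (π k)} := by
    simp only [Set.ofPred_exists, Set.ofPred_and, Set.ofPred_forall]
    exact .iUnion fun j => (h Ψ j).inter (.iInter fun k => .iInter fun _ => h Φ k)
  match φ with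
  | .next Φ => simpa only [SatPath] using h Φ 1
  | .until Φ Ψ => simpa only [SatPath] using hU Φ Ψ
  | .weakUntil Φ Ψ =>
    simp only [SatPath, Set.ofPred_or, Set.ofPred_forall]
    exact (hU Φ Ψ).union (.iInter fun i => h Φ i)

mutual

/-- State formulas are invariant under homomorphisms. -/
theorem satState_iff_of_isHom {D D' : MarkovChain AP} {f : D.State → D'.State}
    (hf : D.IsHom D' f) : ∀ (Φ : StateFormula AP) (s : D.State),
      SatState D Φ s ↔ SatState D' Φ (f s)
  | .atom a, s => by simp only [SatState, hf.label]
  | .and Φ Ψ, s => by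
    simp only [SatState, satState_iff_of_isHom hf Φ s, satState_iff_of_isHom hf Ψ s]
  | .neg Φ, s => by simp only [SatState, satState_iff_of_isHom hf Φ s]
  | .prob c q φ, s => by
    have h : (D.pathMeasure s).real {π | π 0 = s ∧ SatPath D φ π} =
        (D'.pathMeasure (f s)).real {π | π 0 = f s ∧ SatPath D' φ π} := by
      have hm : MeasurableSet {π : ℕ → D'.State | π 0 = f s ∧ SatPath D' φ π} :=
        (measurableSet_eq_fun (measurable_pi_apply 0) measurable_const).inter
          (measurableSet_satPath D' φ)
      rw [← hf.pathMeasure_map, map_measureReal_apply (MarkovChain.IsHom.measurable_comp f _) hm]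
      -- The two events agree only almost surely: `f (π 0) = f s` does not force `π 0 = s` when `f`
      -- is not injective.
      refine measureReal_congr ?_
      filter_upwards [D.ae_pathMeasure_zero s] with π hπ
      refine propext ?_
      change (π 0 = s ∧ SatPath D φ π) ↔ (f (π 0) = f s ∧ SatPath D' φ (f ∘ π))
      simp only [hπ, true_and, satPath_iff_of_isHom hf φ π]
    simp only [SatState, h]

/-- Path formulas are invariant under homomorphisms. -/
theorem satPath_iff_of_isHom {D D' : MarkovChain AP} {f : D.State → D'.State}
    (hf : D.IsHom D' f) : ∀ (φ : PathFormula AP) (π : ℕ → D.State),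
      SatPath D φ π ↔ SatPath D' φ (f ∘ π)
  | .next Φ, π => by simp only [SatPath, satState_iff_of_isHom hf Φ, Function.comp]
  | .until Φ Ψ, π => by
    simp only [SatPath, satState_iff_of_isHom hf Φ, satState_iff_of_isHom hf Ψ, Function.comp]
  | .weakUntil Φ Ψ, π => by
    simp only [SatPath, satState_iff_of_isHom hf Φ, satState_iff_of_isHom hf Ψ, Function.comp]

end

theorem models_iff_of_isHom {D D' : MarkovChain AP} {f : D.State → D'.State}
    (hf : D.IsHom D' f) (h : f D.init = D'.init) (Φ : StateFormula AP) :
    Models D Φ ↔ Models D' Φ := by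
  rw [Models, Models, satState_iff_of_isHom hf, h]

theorem satState_top [Nonempty AP] (D : MarkovChain AP) (s : D.State) :
    SatState D StateFormula.top s := by
  simp only [StateFormula.top, StateFormula.or, SatState]
  tauto

theorem not_models_bot [Nonempty AP] (D : MarkovChain AP) : ¬ Models D StateFormula.bot := by
  simpa only [Models, StateFormula.bot, SatState, not_not] using satState_top D _

theorem not_equivalent_bot_iff [Nonempty AP] (Φ : StateFormula AP) :
    ¬ Φ.Equivalent StateFormula.bot ↔ ∃ D, Models D Φ := by
  simp [StateFormula.Equivalent, not_models_bot]

/-- The event is the countable union, over times `n` and `Φ`-states `t`, of the events `π n = t`, so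
it has positive probability iff one of them does. -/
theorem satState_posReach_iff [Nonempty AP] (D : MarkovChain AP) (Φ : StateFormula AP)
    (s : D.State) : SatState D Φ.posReach s ↔ ∃ t, D.Reaches s t ∧ SatState D Φ t := by
  have hset : {π : ℕ → D.State | SatPath D (PathFormula.until StateFormula.top Φ) π} =
      ⋃ (n : ℕ) (t : {t // SatState D Φ t}), {π | π n = t.1} := by
    ext π
    simp [SatPath, satState_top]
  have hμ : D.pathMeasure s
        {π | π 0 = s ∧ SatPath D (PathFormula.until StateFormula.top Φ) π} =
      D.pathMeasure s {π | SatPath D (PathFormula.until StateFormula.top Φ) π} := by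
    refine measure_congr ?_
    filter_upwards [D.ae_pathMeasure_zero s] with π hπ
    refine propext ?_
    change (π 0 = s ∧ SatPath D (PathFormula.until StateFormula.top Φ) π) ↔
      SatPath D (PathFormula.until StateFormula.top Φ) π
    simp only [hπ, true_and]
  have h1 : SatState D Φ.posReach s ↔ D.pathMeasure s
      {π | SatPath D (PathFormula.until StateFormula.top Φ) π} ≠ 0 := by
    rw [← hμ]
    simp only [StateFormula.posReach, SatState, Cmp.holds, gt_iff_lt, Set.Icc.coe_zero]
    rw [measureReal_def, ENNReal.toReal_pos_iff, pos_iff_ne_zero]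
    exact and_iff_left (measure_lt_top _ _)
  rw [h1, hset, Ne, measure_iUnion_null_iff]
  simp only [measure_iUnion_null_iff, D.reaches_iff]
  push Not
  constructor
  · rintro ⟨n, ⟨t, ht⟩, h⟩
    exact ⟨t, ⟨n, h⟩, ht⟩
  · rintro ⟨t, ⟨n, h⟩, ht⟩
    exact ⟨n, ⟨t, ht⟩, h⟩

end PCTL

end

-- Probability mass functions

/-- A strict inequality at one point would make the total masses differ, but both are one. -/
theorem PMF.eq_of_le {α : Type*} {p q : PMF α} (h : ∀ a, p a ≤ q a) : p = q := by
  refine PMF.ext fun a => (h a).antisymm (le_of_not_gt fun ha => ?_)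
  have := ENNReal.tsum_lt_tsum (p.tsum_coe ▸ ENNReal.one_ne_top) h ha
  rw [p.tsum_coe, q.tsum_coe] at this
  exact this.false

/-- Points outside the range of `f` need no hypothesis: the inequality is trivial there, and
`PMF.eq_of_le` upgrades it to equality. For a suffix this says that no probability escapes the
subtree. -/
theorem PMF.map_eq_of_injective {α β : Type*} {p : PMF α} {q : PMF β} {f : α → β}
    (hf : f.Injective) (h : ∀ a, p a = q (f a)) : p.map f = q := by
  refine PMF.eq_of_le fun b => ?_
  classical
  rw [PMF.map_apply]
  by_cases hb : ∃ a, f a = b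
  · obtain ⟨a, rfl⟩ := hb
    rw [tsum_eq_single a fun a' ha' => if_neg fun h => ha' (hf h.symm), if_pos rfl, h]
  · simp only [not_exists] at hb
    simp [fun a => Ne.symm (hb a)]

theorem PMF.map_bindOnSupport_pure {α β : Type*} {p : PMF α} {g : ∀ a ∈ p.support, β} {f : β → α}
    (h : ∀ a ha, f (g a ha) = a) : (p.bindOnSupport fun a ha => PMF.pure (g a ha)).map f = p := by
  rw [← PMF.bind_pure_comp, ← PMF.bindOnSupport_eq_bind, PMF.bindOnSupport_bindOnSupport]
  simp [h]

theorem PMF.bindOnSupport_pure_apply {α β : Type*} {p : PMF α} {g : ∀ a ∈ p.support, β}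
    (hg : ∀ a ha b hb, g a ha = g b hb → a = b) {a : α} (ha : a ∈ p.support) :
    (p.bindOnSupport fun a ha => PMF.pure (g a ha)) (g a ha) = p a := by
  rw [PMF.bindOnSupport_apply, tsum_eq_single a]
  · rw [dif_neg ((PMF.mem_support_iff _ _).1 ha), PMF.pure_apply, if_pos rfl, mul_one]
  · intro b hb
    split_ifs with h0
    · exact mul_zero _
    · rw [PMF.pure_apply, if_neg fun h => hb (hg _ _ _ _ h.symm), mul_zero]

-- Total trees as Markov chains

namespace PTree

variable {N M AP : Type*}

theorem nodes_ne_nil {T : PTree N AP} (π : T.nodes) : π.1 ≠ [] :=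
  fun h => T.nil_notMem (h ▸ π.2)

theorem prob_pos_iff (T : PTree N AP) (π π' : T.nodes) :
    0 < T.prob π π' ↔ ∃ n : N, (π' : List N) = (π : List N) ++ [n] := by
  rw [← T.edge_pos, prob]
  cases T.edge π <;> simp

/-- The root of a tree. -/
def rootNode (T : PTree N AP) : T.nodes := ⟨[T.root.choose], T.root.choose_spec.1⟩

/-- A node of length at least two receives a positive edge from its parent, whereas a node of length
one extends no node. Expressed by edge probabilities alone, being the root is visibly invariant
under isomorphism. -/
theorem eq_rootNode_iff (T : PTree N AP) (π : T.nodes) :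
    π = T.rootNode ↔ ∀ π', T.prob π' π = 0 := by
  constructor
  · rintro rfl π'
    by_contra h
    obtain ⟨n, hn⟩ := (T.prob_pos_iff _ _).1 (pos_iff_ne_zero.2 h)
    have := congrArg List.length hn
    simp only [rootNode, List.length_append, List.length_singleton] at this
    exact nodes_ne_nil π' (List.length_eq_zero_iff.1 (by omega))
  · intro h
    obtain ⟨l, n, hl⟩ := (List.eq_nil_or_concat' π.1).resolve_left (nodes_ne_nil π)
    by_cases hl' : l = []
    · refine Subtype.ext ?_
      subst hl'
      have h1 : [n] ∈ T.nodes := by simpa only [hl, List.nil_append] using π.2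
      rw [hl, rootNode, T.root.choose_spec.2 n h1]
      rfl
    · have hmem : l ∈ T.nodes := T.prefix_mem _ π.2 l (hl ▸ List.prefix_append _ _) hl'
      exact absurd (h ⟨l, hmem⟩) ((T.prob_pos_iff _ _).2 ⟨n, hl⟩).ne'

theorem IsTotal.edge_isSome {T : PTree N AP} (hT : T.IsTotal) (π : T.nodes) :
    (T.edge π).isSome := by
  obtain ⟨π₂, h₂, ⟨l, rfl⟩, hne⟩ := hT π π.2
  obtain _ | ⟨n, l⟩ := l
  · simp at hne
  · have hmem : π.1 ++ [n] ∈ T.nodes := T.prefix_mem _ h₂ _ ⟨l, by simp⟩ (by simp)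
    obtain ⟨μ, h, -⟩ := (T.edge_pos π ⟨_, hmem⟩).2 ⟨n, rfl⟩
    simp [h]

theorem Iso.map_rootNode {T₁ : PTree N AP} {T₂ : PTree M AP} {e : T₁.nodes ≃ T₂.nodes}
    (he : ∀ π π', T₁.prob π π' = T₂.prob (e π) (e π')) : e T₁.rootNode = T₂.rootNode := by
  rw [eq_rootNode_iff, e.surjective.forall]
  intro π
  rw [← he]
  exact (T₁.eq_rootNode_iff _).1 rfl π

section Chain

variable {N M : Type} [Countable N] [Countable M]

/-- A total tree as a Markov chain whose states are the nodes. -/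
abbrev chain (T : PTree N AP) (hT : T.IsTotal) : MarkovChain AP where
  State := T.nodes
  countable := inferInstance
  step π := (T.edge π).get (hT.edge_isSome π)
  label := T.label
  init := T.rootNode

theorem chain_step_apply (T : PTree N AP) (hT : T.IsTotal) (π π' : T.nodes) :
    (T.chain hT).step π π' = T.prob π π' := by
  obtain ⟨μ, h⟩ := Option.isSome_iff_exists.1 (hT.edge_isSome π)
  simp only [chain, prob, h, Option.get_some, Option.elim_some]

/-- Injectivity suffices, so this covers both isomorphisms and inclusions of suffixes. -/
theorem isHom_chain {T₁ : PTree N AP} {T₂ : PTree M AP} (h₁ : T₁.IsTotal) (h₂ : T₂.IsTotal)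
    {f : T₁.nodes → T₂.nodes} (hf : f.Injective) (hl : ∀ π, T₁.label π = T₂.label (f π))
    (hp : ∀ π π', T₁.prob π π' = T₂.prob (f π) (f π')) :
    (T₁.chain h₁).IsHom (T₂.chain h₂) f where
  label := hl
  step π := PMF.map_eq_of_injective hf fun π' =>
    (T₁.chain_step_apply h₁ π π').trans ((hp π π').trans (T₂.chain_step_apply h₂ _ _).symm)

theorem Iso.models_chain_iff {T₁ : PTree N AP} {T₂ : PTree M AP} (h : T₁.Iso T₂)
    (h₁ : T₁.IsTotal) (h₂ : T₂.IsTotal) (Φ : PCTL.StateFormula AP) :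
    PCTL.Models (T₁.chain h₁) Φ ↔ PCTL.Models (T₂.chain h₂) Φ := by
  obtain ⟨e, hl, hp⟩ := h
  exact PCTL.models_iff_of_isHom (isHom_chain h₁ h₂ e.injective hl hp) (Iso.map_rootNode hp) Φ

end Chain

end PTree

namespace MarkovChain

variable {AP : Type*}

/-! ### Unfoldings -/

/-- The last state of a node of the unfolding. -/
def lastState (D : MarkovChain AP) (π : D.unfolding.nodes) : D.State :=
  π.1.getLast (IsNode.ne_nil π.2)

theorem isTotal_unfolding (D : MarkovChain AP) : D.unfolding.IsTotal := by
  intro π hπ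
  obtain ⟨t, ht⟩ := (D.step (π.getLast (IsNode.ne_nil hπ))).support_nonempty
  exact ⟨π ++ [t], IsNode.append hπ ht, List.prefix_append _ _, by simp⟩

theorem rootNode_unfolding (D : MarkovChain AP) : D.unfolding.rootNode = ⟨[D.init], .root⟩ := by
  have h : D.IsNode [D.unfolding.root.choose] := D.unfolding.root.choose_spec.1
  exact Subtype.ext (congrArg (fun s => [s]) h.singleton)

theorem isHom_lastState (D : MarkovChain AP) :
    (D.unfolding.chain D.isTotal_unfolding).IsHom D D.lastState where
  label _ := rfl
  step _ :=
    PMF.map_bindOnSupport_pure fun _ _ => List.getLast_append_singleton _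

theorem models_chain_unfolding_iff (D : MarkovChain AP) (Φ : PCTL.StateFormula AP) :
    PCTL.Models (D.unfolding.chain D.isTotal_unfolding) Φ ↔ PCTL.Models D Φ :=
  PCTL.models_iff_of_isHom D.isHom_lastState
    (by change D.lastState D.unfolding.rootNode = _; rw [rootNode_unfolding]; rfl) Φ

theorem unfolding_prob_append (D : MarkovChain AP) (π : D.unfolding.nodes) (t : D.State)
    (h : D.IsNode (π.1 ++ [t])) :
    D.unfolding.prob π ⟨π.1 ++ [t], h⟩ = D.step (D.lastState π) t := by
  refine PMF.bindOnSupport_pure_apply (p := D.step (D.lastState π)) (fun a _ b _ hab => ?_)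
    (IsNode.of_append π.2 h)
  simpa using congrArg Subtype.val hab

theorem unfolding_prob_eq_zero (D : MarkovChain AP) (π π' : D.unfolding.nodes)
    (h : ∀ t, π'.1 ≠ π.1 ++ [t]) : D.unfolding.prob π π' = 0 := by
  by_contra h0
  obtain ⟨t, ht⟩ := (D.unfolding.prob_pos_iff _ _).1 (pos_iff_ne_zero.2 h0)
  exact h t ht

/-- The chain `D` with initial state `t`. -/
abbrev withInit (D : MarkovChain AP) (t : D.State) : MarkovChain AP := { D with init := t }

theorem isHom_withInit (D : MarkovChain AP) (t : D.State) : (D.withInit t).IsHom D id where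
  label _ := rfl
  step _ := PMF.map_id _

theorem models_withInit_iff (D : MarkovChain AP) (t : D.State) (Φ : PCTL.StateFormula AP) :
    PCTL.Models (D.withInit t) Φ ↔ PCTL.SatState D Φ t :=
  PCTL.satState_iff_of_isHom (D.isHom_withInit t) Φ t

theorem exists_isNode_of_reaches {D : MarkovChain AP} {t : D.State} (h : D.Reaches D.init t) :
    ∃ π, D.IsNode (π ++ [t]) := by
  induction h with
  | refl => exact ⟨[], .root⟩
  | tail _ h ih =>
    obtain ⟨π, hπ⟩ := ih
    exact ⟨_, hπ.snoc h⟩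

theorem IsNode.append_withInit {D : MarkovChain AP} {π : List D.State} {t : D.State}
    (h : D.IsNode (π ++ [t])) {ρ : List D.State} (hρ : (D.withInit t).IsNode ρ) :
    D.IsNode (π ++ ρ) := by
  refine IsNode.rec (D := D.withInit t) (motive := fun ρ _ => D.IsNode (π ++ ρ)) h ?_ hρ
  intro σ s u _ hu ih
  have h1 : D.IsNode (π ++ σ ++ [s]) := by rw [List.append_assoc]; exact ih
  simpa only [List.append_assoc] using IsNode.snoc (D := D) h1 hu

/-- The unfolding from a state reached at a later time is a suffix of the unfolding. -/
theorem isSuffix_unfolding_withInit {D : MarkovChain AP} {π : List D.State} {t : D.State}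
    (hπ : π ≠ []) (h : D.IsNode (π ++ [t])) :
    PTree.IsSuffix (N := D.State) (D.withInit t).unfolding D.unfolding := by
  -- The shift is by `π` and not by `π ++ [t]`, because the nodes of the restarted unfolding already
  -- begin with `t`.
  refine ⟨π, h.prefix_mem _ (List.prefix_append _ _) hπ, fun _ hρ => h.append_withInit hρ, ?_, ?_⟩
  · intro ρ
    have := IsNode.ne_nil ρ.2
    exact congrArg D.label (List.getLast_append_of_ne_nil _ this).symm
  · rintro ρ ⟨ρ', hρ'⟩
    by_cases hc : ∃ u, ρ' = ρ.1 ++ [u]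
    · obtain ⟨u, rfl⟩ := hc
      have hu : D.IsNode (π ++ ρ.1 ++ [u]) := by
        rw [List.append_assoc]; exact h.append_withInit hρ'
      refine ((D.withInit t).unfolding_prob_append ρ u hρ').trans ?_
      have h1 := D.unfolding_prob_append ⟨π ++ ρ.1, h.append_withInit ρ.2⟩ u hu
      have h2 : D.lastState ⟨π ++ ρ.1, h.append_withInit ρ.2⟩ = (D.withInit t).lastState ρ :=
        List.getLast_append_of_ne_nil _ (IsNode.ne_nil ρ.2)
      rw [h2] at h1
      refine h1.symm.trans ?_
      congr 2
      exact List.append_assoc _ _ _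
    · push Not at hc
      rw [unfolding_prob_eq_zero _ _ _ hc, unfolding_prob_eq_zero]
      intro u hu
      exact hc u (by simpa only [List.append_assoc, List.append_cancel_left_eq] using hu)

/-- A chain with natural numbers as states that has the same behaviour as `D`. -/
abbrev natChain (D : MarkovChain AP) : MarkovChain AP where
  State := ℕ
  countable := inferInstance
  -- A number that encodes no state behaves like an arbitrary fixed state, so that decoding is a
  -- homomorphism onto `D`.
  step n := (D.step (@Function.invFun _ _ ⟨D.init⟩ (exists_injective_nat D.State).choose n)).map
    (exists_injective_nat D.State).choose
  label n := D.label (@Function.invFun _ _ ⟨D.init⟩ (exists_injective_nat D.State).choose n)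
  init := (exists_injective_nat D.State).choose D.init

theorem models_natChain_iff (D : MarkovChain AP) (Φ : PCTL.StateFormula AP) :
    PCTL.Models D.natChain Φ ↔ PCTL.Models D Φ := by
  have : Nonempty D.State := ⟨D.init⟩
  have he := Function.leftInverse_invFun (exists_injective_nat D.State).choose_spec
  have hf : D.natChain.IsHom D (Function.invFun (exists_injective_nat D.State).choose) :=
    { label := fun _ => rfl
      step := fun n => by
        change PMF.map _ (PMF.map _ _) = _
        rw [PMF.map_comp, he.comp_eq_id, PMF.map_id] }
  exact PCTL.models_iff_of_isHom hf (he _) Φ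

end MarkovChain

-- Trees as unfoldings of their chains, and suffixes

namespace PTree

variable {N : Type} {AP : Type*} [Countable N]

theorem mem_support_chain_step_iff (T : PTree N AP) (hT : T.IsTotal) (π π' : T.nodes) :
    π' ∈ ((T.chain hT).step π).support ↔ ∃ n : N, (π' : List N) = (π : List N) ++ [n] := by
  rw [PMF.mem_support_iff, ← pos_iff_ne_zero, ← T.prob_pos_iff]
  exact iff_of_eq (congrArg _ (T.chain_step_apply hT π π'))

/-- In a tree every non-root node has a unique parent and the root has none, so a path from the root
is recovered backwards from its last node. -/
theorem isNode_chain_eq {T : PTree N AP} {hT : T.IsTotal} {l : List (T.chain hT).State}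
    (hl : (T.chain hT).IsNode l) : ∀ {l' : List (T.chain hT).State}
      (hl' : (T.chain hT).IsNode l'), l.getLast hl.ne_nil = l'.getLast hl'.ne_nil → l = l' := by
  have hroot {s t : T.nodes} (h : t ∈ ((T.chain hT).step s).support) : t ≠ T.rootNode := by
    rw [PMF.mem_support_iff] at h
    exact fun h1 => h ((T.chain_step_apply hT s t).trans ((T.eq_rootNode_iff t).1 h1 s))
  induction hl with
  | root =>
    intro l' hl' h
    cases hl' with
    | root => rfl
    | snoc _ ht => exact absurd (by simpa using h.symm) (hroot ht)
  | snoc h1 ht ih =>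
    intro l' hl' h
    cases hl' with
    | root => exact absurd (by simpa using h) (hroot ht)
    | snoc h1' ht' =>
      simp only [List.getLast_append_singleton] at h
      subst h
      obtain ⟨n, hn⟩ := (mem_support_chain_step_iff T hT _ _).1 ht
      obtain ⟨n', hn'⟩ := (mem_support_chain_step_iff T hT _ _).1 ht'
      have hs := Subtype.ext (List.append_inj' (hn.symm.trans hn') rfl).1
      rw [ih h1' (by simpa using hs)]

theorem exists_isNode_chain {T : PTree N AP} (hT : T.IsTotal) (l : List N) :
    ∀ hl : l ∈ T.nodes, ∃ π : (T.chain hT).unfolding.nodes, (T.chain hT).lastState π = ⟨l, hl⟩ := by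
  induction l using List.reverseRecOn with
  | nil => exact fun hl => absurd hl T.nil_notMem
  | append_singleton l n ih =>
    intro hl
    by_cases h : l = []
    · subst h
      refine ⟨⟨[T.rootNode], .root⟩, Subtype.ext ?_⟩
      change [T.root.choose] = [n]
      rw [T.root.choose_spec.2 n hl]
    · obtain ⟨π, hπ⟩ := ih (T.prefix_mem _ hl l (List.prefix_append _ _) h)
      have hs : (⟨l ++ [n], hl⟩ : T.nodes) ∈
          ((T.chain hT).step ((T.chain hT).lastState π)).support := by
        rw [hπ]
        exact (mem_support_chain_step_iff T hT _ _).2 ⟨n, rfl⟩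
      exact ⟨⟨_, MarkovChain.IsNode.append π.2 hs⟩, List.getLast_append_singleton _⟩

/-- A total tree is the unfolding of its chain up to renaming of nodes. -/
theorem iso_unfolding_chain (T : PTree N AP) (hT : T.IsTotal) :
    T.Iso (T.chain hT).unfolding := by
  have hinj : (T.chain hT).lastState.Injective := fun π π' h =>
    Subtype.ext (isNode_chain_eq π.2 π'.2 h)
  have hbij : (T.chain hT).lastState.Bijective :=
    ⟨hinj, fun l => exists_isNode_chain hT l.1 l.2⟩
  have hp (π π' : (T.chain hT).unfolding.nodes) :
      T.prob ((T.chain hT).lastState π) ((T.chain hT).lastState π') =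
        (T.chain hT).unfolding.prob π π' := by
    by_cases hc : ∃ t, π'.1 = π.1 ++ [t]
    · obtain ⟨t, ht⟩ := hc
      obtain ⟨π', hπ'⟩ := π'
      subst ht
      refine Eq.trans ?_ ((MarkovChain.unfolding_prob_append _ π t hπ').trans
        (T.chain_step_apply hT _ _)).symm
      congr 1
      exact List.getLast_append_singleton _
    · rw [MarkovChain.unfolding_prob_eq_zero _ _ _ fun t ht => hc ⟨t, ht⟩]
      -- A nonzero edge of `T` would give `π` a child in the unfolding with the same last state as
      -- `π'`; by injectivity that child is `π'`, against `hc`.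
      by_contra h0
      rw [← T.chain_step_apply hT] at h0
      have hs := (PMF.mem_support_iff _ _).2 h0
      refine hc ⟨(T.chain hT).lastState π', ?_⟩
      have := @hinj π' ⟨_, MarkovChain.IsNode.append π.2 hs⟩ (List.getLast_append_singleton _).symm
      exact congrArg Subtype.val this
  let e := Equiv.ofBijective _ hbij
  refine ⟨e.symm, fun l => ?_, fun l l' => ?_⟩
  · obtain ⟨π, rfl⟩ := e.surjective l
    rw [e.symm_apply_apply]
    rfl
  · obtain ⟨π, rfl⟩ := e.surjective l
    obtain ⟨π', rfl⟩ := e.surjective l'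
    rw [e.symm_apply_apply, e.symm_apply_apply]
    exact hp π π'

/-- A formula that holds in a suffix is reached with positive probability. -/
theorem IsSuffix.models_posReach [Nonempty AP] {T T' : PTree N AP} (h : T'.IsSuffix T)
    (hT : T.IsTotal) (hT' : T'.IsTotal) {Φ : PCTL.StateFormula AP}
    (hΦ : PCTL.Models (T'.chain hT') Φ) : PCTL.Models (T.chain hT) Φ.posReach := by
  obtain ⟨π, -, hmem, hl, hp⟩ := h
  have hf := isHom_chain hT' hT (f := fun ρ => ⟨π ++ ρ, hmem ρ ρ.2⟩)
    (fun ρ ρ' h => Subtype.ext (List.append_cancel_left (congrArg Subtype.val h))) hl hp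
  refine (PCTL.satState_posReach_iff _ _ _).2 ⟨_, ?_, (PCTL.satState_iff_of_isHom hf Φ _).1 hΦ⟩
  have key (l : List N) : ∀ hl : l ∈ T.nodes, (T.chain hT).Reaches T.rootNode ⟨l, hl⟩ := by
    induction l using List.reverseRecOn with
    | nil => exact fun hl => absurd hl T.nil_notMem
    | append_singleton l n ih =>
      intro hl
      by_cases h : l = []
      · subst h
        have : (⟨[] ++ [n], hl⟩ : T.nodes) = T.rootNode :=
          Subtype.ext (congrArg (fun m => [m]) (T.root.choose_spec.2 n hl))
        rw [this]
        exact .refl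
      · exact (ih (T.prefix_mem _ hl l (List.prefix_append _ _) h)).tail
          ((mem_support_chain_step_iff T hT _ _).2 ⟨n, rfl⟩)
  exact key _ _

end PTree

-- Membership in the property of a formula, and the main theorem

theorem PCTL.StateFormula.mem_property_iff {AP : Type*} (Φ : PCTL.StateFormula AP)
    (T : TotalPT AP) : T ∈ Φ.property ↔ PCTL.Models (T.1.chain T.2) Φ := by
  constructor
  · rintro ⟨D, hD, hT⟩
    rw [hT.models_chain_iff T.2 D.isTotal_unfolding, D.models_chain_unfolding_iff]
    exact hD
  · exact fun h => ⟨_, h, T.1.iso_unfolding_chain T.2⟩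

/-- The unfolding of a chain, with natural numbers as nodes. -/
def MarkovChain.natUnfolding {AP : Type*} (D : MarkovChain AP) : TotalPT AP :=
  ⟨D.natChain.unfolding, D.natChain.isTotal_unfolding⟩

theorem MarkovChain.natUnfolding_mem_property_iff {AP : Type*} (D : MarkovChain AP)
    (Φ : PCTL.StateFormula AP) : D.natUnfolding ∈ Φ.property ↔ PCTL.Models D Φ :=
  (Φ.mem_property_iff _).trans
    ((D.natChain.models_chain_unfolding_iff Φ).trans (D.models_natChain_iff Φ))

end

theorem mainTheorem12 {AP : Type*} [Finite AP] [Nonempty AP] (Φ : PCTL.StateFormula AP) :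
    IsAbsoluteLiveness Φ.property ↔
      ¬ Φ.Equivalent PCTL.StateFormula.bot ∧ Φ.Equivalent Φ.posReach := by
  rw [PCTL.not_equivalent_bot_iff]
  constructor
  · rintro ⟨⟨T, hT⟩, hsuff⟩
    refine ⟨⟨_, (Φ.mem_property_iff T).1 hT⟩, fun D => ⟨fun h => ?_, fun h => ?_⟩⟩
    · exact (PCTL.satState_posReach_iff _ _ _).2 ⟨D.init, .refl, h⟩
    · rw [← D.models_natChain_iff] at h
      obtain ⟨t, ht, hΦ⟩ := (PCTL.satState_posReach_iff _ _ _).1 h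
      obtain ⟨π, hπ⟩ := MarkovChain.exists_isNode_of_reaches ht
      -- A suffix must be taken below an actual node, so an empty `π` is treated apart: then `t` is
      -- the initial state, which already satisfies `Φ`.
      by_cases hne : π = []
      · subst hne
        rw [MarkovChain.IsNode.singleton hπ] at hΦ
        exact (D.models_natChain_iff Φ).1 hΦ
      · refine (D.natUnfolding_mem_property_iff Φ).1 (hsuff D.natUnfolding
          ⟨(D.natChain.withInit t).unfolding, MarkovChain.isTotal_unfolding _⟩
          (MarkovChain.isSuffix_unfolding_withInit hne hπ) ?_)
        refine (Φ.mem_property_iff _).2 ?_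
        exact (MarkovChain.models_chain_unfolding_iff _ Φ).2
          ((D.natChain.models_withInit_iff t Φ).2 hΦ)
  · rintro ⟨⟨D, hD⟩, hequiv⟩
    refine ⟨⟨_, (D.natUnfolding_mem_property_iff Φ).2 hD⟩, fun T T' h hT' => ?_⟩
    rw [PCTL.StateFormula.mem_property_iff] at hT' ⊢
    exact (hequiv _).2 (h.models_posReach T.2 T'.2 hT')
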